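/- Let $X_0,X_1,X_2,\dots$ be a time-homogeneous Markov chain on a finite nonempty set $\mathcal S$ with transition matrix $\mathcal P$, whose $n$-step transition probabilities are $p^{(n)}_{ij}=(\mathcal P^n)_{ij}$. Let $\ell_{jk}\ge 0$ $(j,k\in\mathcal S)$ be the loss of predicting $k$ when the state is $j$, and let $c\ge 0$ be the cost of a query. In each slot $t=0,1,2,\dots$ a monitor either queries, which costs $c$ and reveals $X_t$, or predicts some $\hat X_t\in\mathcal S$, which costs $\ell_{X_t\hat X_t}$ and reveals nothing. An online policy chooses the action in slot $t$, possibly at random, on the basis of the monitor's past predictions and of the states revealed by past queries. For a policy $\pi$ let $C_t^\pi$ be the cost incurred in slot $t$ and $$\Gamma_T(\pi)=\frac1T\sum_{t=0}^{T}\mathbb E[C^\pi_t].$$ For a given law of $X_0$, call $\pi$ optimal if $\Gamma(\pi)=\lim_{T\to\infty}\Gamma_T(\pi)$ exists and $\Gamma(\pi)\le\liminf_{T\to\infty}\Gamma_T(\pi')$ for every online policy $\pi'$. Then there are an online policy $\pi^\star$ and numbers $\mu_i^\star\in\{1,2,3,\dots\}\cup\{\infty\}$, $i\in\mathcal S$,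 such that $\pi^\star$ is optimal for every law of $X_0$, queries in slot $0$, and satisfies: (i) $\pi^\star$ is stationary: after the first query, its decision in a slot depends only on the state revealed by the latest query and on the number of slots since that query. (ii) If the latest query was in slot $\tau$ and revealed $X_\tau=i$, then in each slot $t=\tau+n$ with $1\le n<\mu_i^\star$ the policy predicts (deterministically) a state $k$ that minimizes $\sum_{j\in\mathcal S}p^{(n)}_{ij}\ell_{jk}$ over $k\in\mathcal S$; and, if $\mu_i^\star<\infty$, it queries next in slot $\tau+\mu_i^\star$. If $\mu_i^\star=\infty$, it never queries again. -/

import Mathlib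

open Filter Topology

/-- The data of the query-or-predict problem on a finite state set `S`: the transition
probabilities of the node's Markov chain, the loss `loss x k` of predicting `k` while the
state is `x`, and the cost of one query. -/
structure TrackingModel (S : Type*) where
  /-- `trans i` is the distribution of the next state when the present state is `i`. -/
  trans : S → PMF S
  loss : S → S → ℝ
  loss_nonneg : ∀ x k, 0 ≤ loss x k
  queryCost : ℝ
  queryCost_nonneg : 0 ≤ queryCost

/-- What the monitor does in one slot. -/
inductive TrackingAction (S : Type*) where
  | query : TrackingAction S
  | predict (k : S) : TrackingAction S

/-- What the monitor remembers of one slot: the state that a query revealed, or its own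
prediction (a prediction reveals nothing about the state or the loss). -/
inductive SlotRecord (S : Type*) where
  | queried (x : S) : SlotRecord S
  | predicted (k : S) : SlotRecord S

/-- The information at the beginning of slot `t`: the records of the slots
`t - 1, t - 2, …, 0`, in this order (most recent slot first). -/
abbrev TrackingHistory (S : Type*) := List (SlotRecord S)

/-- An online (causal) policy, possibly randomized and history dependent. -/
abbrev OnlinePolicy (S : Type*) := TrackingHistory S → PMF (TrackingAction S)

/-- The record left by an action taken while the state is `x`. -/
def slotRecord {S : Type*} (x : S) : TrackingAction S → SlotRecord S
  | .query => .queried x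
  | .predict k => .predicted k

/-- `latestQuery h = some (i, n)`: the latest query revealed state `i`, and it was made `n ≥ 1`
slots before the present slot. It is `none` if there has been no query. -/
def latestQuery {S : Type*} : TrackingHistory S → Option (S × ℕ)
  | [] => none
  | .queried x :: _ => some (x, 1)
  | .predicted _ :: h => (latestQuery h).map fun q => (q.1, q.2 + 1)

/-- The decisions depend only on the latest queried state and on the time elapsed since that
query (not on the slot index, nor on anything before that query). -/
def IsStationaryPolicy {S : Type*} (π : OnlinePolicy S) : Prop :=
  ∀ (h h' : TrackingHistory S) (i : S) (n : ℕ),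
    latestQuery h = some (i, n) → latestQuery h' = some (i, n) → π h = π h'

namespace TrackingModel

variable {S : Type*}

/-- Joint law of the state in slot `t` and of the history at the beginning of slot `t`, when the
initial state has law `ν` and the policy `π` is used. The state moves according to `trans`,
whatever the action. -/
noncomputable def jointLaw (M : TrackingModel S) (ν : PMF S) (π : OnlinePolicy S) :
    ℕ → PMF (S × TrackingHistory S)
  | 0 => ν.map fun x => (x, [])
  | t + 1 => (jointLaw M ν π t).bind fun z =>
      (π z.2).bind fun a => (M.trans z.1).map fun y => (y, slotRecord z.1 a :: z.2)

/-- Joint law of the state and the action in slot `t`. -/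
noncomputable def slotLaw (M : TrackingModel S) (ν : PMF S) (π : OnlinePolicy S) (t : ℕ) :
    PMF (S × TrackingAction S) :=
  (M.jointLaw ν π t).bind fun z => (π z.2).map fun a => (z.1, a)

/-- Expected cost of slot `t`: the query cost if there is a query, the prediction loss otherwise. -/
noncomputable def expectedCost [Fintype S] (M : TrackingModel S) (ν : PMF S)
    (π : OnlinePolicy S) (t : ℕ) : ℝ :=
  ∑ x, ((M.slotLaw ν π t (x, .query)).toReal * M.queryCost
    + ∑ k, (M.slotLaw ν π t (x, .predict k)).toReal * M.loss x k)

/-- The time average `(1 / T) ∑_{t = 0}^{T}` of the expected costs. -/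
noncomputable def averageCost [Fintype S] (M : TrackingModel S) (ν : PMF S)
    (π : OnlinePolicy S) (T : ℕ) : ℝ :=
  (1 / (T : ℝ)) * ∑ t ∈ Finset.range (T + 1), M.expectedCost ν π t

/-- `π` minimizes the sum average cost among all online policies: its own time averages converge,
and no policy has a smaller lower limit of the time averages. -/
def IsOptimal [Fintype S] (M : TrackingModel S) (ν : PMF S) (π : OnlinePolicy S) : Prop :=
  ∃ g : ℝ, Tendsto (M.averageCost ν π) atTop (𝓝 g) ∧
    ∀ π' : OnlinePolicy S,
      (g : EReal) ≤ liminf (fun T : ℕ => ((M.averageCost ν π' T : ℝ) : EReal)) atTop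

/-- The transition matrix. -/
noncomputable def transMatrix (M : TrackingModel S) : Matrix S S ℝ :=
  Matrix.of fun i j => (M.trans i j).toReal

/-- Expected loss of predicting `k` in the `n`-th slot after a query that revealed `i`. -/
noncomputable def predictionLoss [Fintype S] [DecidableEq S] (M : TrackingModel S)
    (i : S) (n : ℕ) (k : S) : ℝ :=
  ∑ j, (M.transMatrix ^ n) i j * M.loss j k

/-- `k` is an optimal prediction in the `n`-th slot after a query that revealed `i`. -/
def IsOptimalPrediction [Fintype S] [DecidableEq S] (M : TrackingModel S)
    (i : S) (n : ℕ) (k : S) : Prop :=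
  ∀ k' : S, M.predictionLoss i n k ≤ M.predictionLoss i n k'

/-- After a query that revealed `i`, the policy predicts optimally in each of the next `μ i - 1`
slots and then queries again in the `μ i`-th slot; for `μ i = ⊤` it predicts optimally for ever. -/
def FollowsThresholds [Fintype S] [DecidableEq S] (M : TrackingModel S)
    (π : OnlinePolicy S) (μ : S → ℕ∞) : Prop :=
  ∀ (h : TrackingHistory S) (i : S) (n : ℕ), latestQuery h = some (i, n) →
    ((n : ℕ∞) < μ i → ∃ k, M.IsOptimalPrediction i n k ∧ π h = PMF.pure (.predict k)) ∧
    ((n : ℕ∞) = μ i → π h = PMF.pure .query)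

end TrackingModel

/-! ### The discounted problem on beliefs. -/

namespace TrackingModel

open scoped Matrix

variable {S : Type*}

/-! Write P for the transition matrix and c for the query cost. The belief b about the state carries
all relevant information: a prediction moves it to bP, a query revealing x moves it to the row P_x.
The chain may have several recurrent classes, so the optimal average cost is not a constant; it has
the form b·w with Pw = w.

A bounded solution U, w of the average cost optimality equation comes from letting the discount
factor α tend to 1. With V the discounted value and v(x) = V(P_x), one has α b·v ≤ V(b) ≤ c + α b·v:
the upper bound queries at once, the lower bound says that information does not hurt
(`dotProduct_discountedValue_le`). Hence v - Pv is bounded uniformly in α, and a bounded generalized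
inverse of 1 - P splits v into a harmonic q and a bounded remainder
(`exists_harmonic_approximation`). Then V(b) - b·q and (1 - α)q stay bounded, and their limits are U
and w (`exists_averageOptimalityEquation`).

By induction on the horizon, T slots cost at least T b·w up to a constant under any policy
(`SolvesOptimalityEquation.le_costToGo`), and at most that under a policy taking minimizing actions
(`SolvesOptimalityEquation.costToGo_le`). While the monitor predicts after seeing i, its beliefs are
the rows (P^n)_i, so the choice depends only on i and n; the threshold is the first n ≥ 1 at which
querying is a minimizer. -/

lemma transMatrix_nonneg (M : TrackingModel S) (i j : S) : 0 ≤ M.transMatrix i j := by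
  simp [transMatrix]

lemma vecMul_transMatrix_nonneg [Fintype S] (M : TrackingModel S) {b : S → ℝ} (hb : 0 ≤ b) :
    0 ≤ b ᵥ* M.transMatrix := by
  intro j
  exact Finset.sum_nonneg fun i _ => mul_nonneg (hb i) (M.transMatrix_nonneg i j)

lemma sum_transMatrix [Fintype S] (M : TrackingModel S) (i : S) :
    ∑ j, M.transMatrix i j = 1 := by
  have h := (M.trans i).tsum_coe
  rw [tsum_fintype] at h
  simp only [transMatrix, Matrix.of_apply]
  rw [← ENNReal.toReal_sum fun j _ => (M.trans i).apply_ne_top j, h, ENNReal.toReal_one]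

lemma sum_vecMul_transMatrix [Fintype S] (M : TrackingModel S) (b : S → ℝ) :
    ∑ j, (b ᵥ* M.transMatrix) j = ∑ i, b i := by
  simp only [Matrix.vecMul, dotProduct]
  rw [Finset.sum_comm]
  simp [← Finset.mul_sum, sum_transMatrix]

/-- The least expected loss of a prediction under the (unnormalized) belief `b`. -/
noncomputable def minLoss [Fintype S] [Nonempty S] (M : TrackingModel S) (b : S → ℝ) : ℝ :=
  Finset.univ.inf' Finset.univ_nonempty fun k => b ⬝ᵥ fun j => M.loss j k

section Discounted

variable [Fintype S] [Nonempty S]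

lemma minLoss_le (M : TrackingModel S) (b : S → ℝ) (k : S) :
    M.minLoss b ≤ b ⬝ᵥ fun j => M.loss j k :=
  Finset.inf'_le _ (Finset.mem_univ k)

lemma minLoss_nonneg (M : TrackingModel S) {b : S → ℝ} (hb : 0 ≤ b) : 0 ≤ M.minLoss b :=
  Finset.le_inf' _ _ fun k _ => Finset.sum_nonneg fun j _ => mul_nonneg (hb j) (M.loss_nonneg j k)

/-- Any single prediction for the mixture can also be used for each row of `B`. -/
lemma dotProduct_minLoss_le (M : TrackingModel S) {b : S → ℝ} (hb : 0 ≤ b) (B : Matrix S S ℝ) :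
    (b ⬝ᵥ fun x => M.minLoss (B x)) ≤ M.minLoss (b ᵥ* B) := by
  refine Finset.le_inf' _ _ fun k _ => ?_
  rw [← Matrix.dotProduct_mulVec]
  exact dotProduct_le_dotProduct_of_nonneg_left (fun x => M.minLoss_le (B x) k) hb

/-- The Bellman operator with discount factor `α`, on functions of the belief. -/
noncomputable def bellman (M : TrackingModel S) (α : ℝ) (V : (S → ℝ) → ℝ) (b : S → ℝ) : ℝ :=
  min (M.minLoss b + α * V (b ᵥ* M.transMatrix))
    (b ⬝ᵥ fun x => M.queryCost + α * V (M.transMatrix x))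

/-- The optimal discounted cost over `n` slots. -/
noncomputable def valueIter (M : TrackingModel S) (α : ℝ) : ℕ → (S → ℝ) → ℝ
  | 0 => fun _ => 0
  | n + 1 => M.bellman α (valueIter M α n)

/-- The optimal discounted cost over the infinite horizon. -/
noncomputable def discountedValue (M : TrackingModel S) (α : ℝ) (b : S → ℝ) : ℝ :=
  ⨆ n, M.valueIter α n b

lemma bellman_mono (M : TrackingModel S) {α : ℝ} (hα : 0 ≤ α) {V W : (S → ℝ) → ℝ}
    (h : ∀ b, 0 ≤ b → V b ≤ W b) {b : S → ℝ} (hb : 0 ≤ b) :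
    M.bellman α V b ≤ M.bellman α W b := by
  refine min_le_min ?_ ?_
  · gcongr
    exact h _ (M.vecMul_transMatrix_nonneg hb)
  · refine dotProduct_le_dotProduct_of_nonneg_left (fun x => ?_) hb
    have := h (M.transMatrix x) (M.transMatrix_nonneg x)
    dsimp only
    gcongr

lemma valueIter_le_succ (M : TrackingModel S) {α : ℝ} (hα : 0 ≤ α) (n : ℕ) :
    ∀ b : S → ℝ, 0 ≤ b → M.valueIter α n b ≤ M.valueIter α (n + 1) b := by
  induction n with
  | zero =>
    intro b hb
    refine le_min ?_ ?_
    · simpa [valueIter] using M.minLoss_nonneg hb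
    · simp only [valueIter, mul_zero, add_zero]
      exact Finset.sum_nonneg fun x _ => mul_nonneg (hb x) M.queryCost_nonneg
  | succ n ih => exact fun b hb => M.bellman_mono hα ih hb

lemma monotone_valueIter (M : TrackingModel S) {α : ℝ} (hα : 0 ≤ α) {b : S → ℝ} (hb : 0 ≤ b) :
    Monotone fun n => M.valueIter α n b :=
  monotone_nat_of_le_succ fun n => M.valueIter_le_succ hα n b hb

/-- The bound is the geometric series of the cost of querying in every slot. -/
lemma valueIter_le (M : TrackingModel S) {α : ℝ} (hα : 0 ≤ α) (hα' : α < 1) (n : ℕ) :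
    ∀ b : S → ℝ, 0 ≤ b → M.valueIter α n b ≤ M.queryCost / (1 - α) * ∑ x, b x := by
  have h1 : 0 < 1 - α := by linarith
  induction n with
  | zero =>
    intro b hb
    exact mul_nonneg (div_nonneg M.queryCost_nonneg h1.le) (Finset.sum_nonneg fun x _ => hb x)
  | succ n ih =>
    intro b hb
    calc M.valueIter α (n + 1) b
        ≤ b ⬝ᵥ fun x => M.queryCost + α * M.valueIter α n (M.transMatrix x) := min_le_right _ _
      _ ≤ b ⬝ᵥ fun _ => M.queryCost / (1 - α) := by
        refine dotProduct_le_dotProduct_of_nonneg_left (fun x => ?_) hb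
        have h := ih (M.transMatrix x) (M.transMatrix_nonneg x)
        rw [sum_transMatrix, mul_one] at h
        have : M.queryCost / (1 - α) = M.queryCost + α * (M.queryCost / (1 - α)) := by
          field_simp
          ring
        rw [this]
        dsimp only
        gcongr
      _ = M.queryCost / (1 - α) * ∑ x, b x := by
        simp [dotProduct, ← Finset.sum_mul, mul_comm]

lemma tendsto_valueIter (M : TrackingModel S) {α : ℝ} (hα : 0 ≤ α) (hα' : α < 1)
    {b : S → ℝ} (hb : 0 ≤ b) :
    Tendsto (fun n => M.valueIter α n b) atTop (𝓝 (M.discountedValue α b)) :=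
  tendsto_atTop_ciSup (M.monotone_valueIter hα hb)
    ⟨_, by rintro _ ⟨n, rfl⟩; exact M.valueIter_le hα hα' n b hb⟩

lemma discountedValue_le (M : TrackingModel S) {α : ℝ} (hα : 0 ≤ α) (hα' : α < 1)
    {b : S → ℝ} (hb : 0 ≤ b) :
    M.discountedValue α b ≤ M.queryCost / (1 - α) * ∑ x, b x :=
  le_of_tendsto' (M.tendsto_valueIter hα hα' hb) fun n => M.valueIter_le hα hα' n b hb

lemma discountedValue_nonneg (M : TrackingModel S) {α : ℝ} (hα : 0 ≤ α) (hα' : α < 1)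
    {b : S → ℝ} (hb : 0 ≤ b) : 0 ≤ M.discountedValue α b :=
  ge_of_tendsto' (M.tendsto_valueIter hα hα' hb) fun n => M.monotone_valueIter hα hb n.zero_le

lemma discountedValue_eq (M : TrackingModel S) {α : ℝ} (hα : 0 ≤ α) (hα' : α < 1)
    {b : S → ℝ} (hb : 0 ≤ b) :
    M.discountedValue α b = M.bellman α (M.discountedValue α) b := by
  refine tendsto_nhds_unique ((M.tendsto_valueIter hα hα' hb).comp (tendsto_add_atTop_nat 1)) ?_
  refine Tendsto.min (tendsto_const_nhds.add
    ((M.tendsto_valueIter hα hα' (M.vecMul_transMatrix_nonneg hb)).const_mul α)) ?_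
  exact tendsto_finsetSum _ fun x _ => (tendsto_const_nhds.add
    ((M.tendsto_valueIter hα hα' (M.transMatrix_nonneg x)).const_mul α)).const_mul (b x)

/-- Information does not hurt: the value of a mixture of beliefs is at least the mixture of
the values. -/
lemma dotProduct_valueIter_le (M : TrackingModel S) {α : ℝ} (hα : 0 ≤ α) {b : S → ℝ}
    (hb : 0 ≤ b) (n : ℕ) :
    ∀ B : Matrix S S ℝ, (b ⬝ᵥ fun x => M.valueIter α n (B x)) ≤ M.valueIter α n (b ᵥ* B) := by
  induction n with
  | zero => simp [valueIter]
  | succ n ih =>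
    intro B
    refine le_min ?_ ?_
    · have h1 := M.dotProduct_minLoss_le hb B
      have h2 := mul_le_mul_of_nonneg_left (ih (B * M.transMatrix)) hα
      rw [← Matrix.vecMul_vecMul] at h2
      refine le_trans ?_ (add_le_add h1 h2)
      rw [← smul_eq_mul α, ← dotProduct_smul, ← dotProduct_add]
      refine dotProduct_le_dotProduct_of_nonneg_left (fun x => ?_) hb
      exact min_le_left _ _
    · rw [← Matrix.dotProduct_mulVec]
      refine dotProduct_le_dotProduct_of_nonneg_left (fun x => ?_) hb
      exact min_le_right _ _

/-- Learning the present state for free replaces `b` by point masses, which does not raise the cost;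
from the point mass at x, dropping the nonnegative cost of the present slot leaves α times the value
at P_x. -/
lemma dotProduct_discountedValue_le [DecidableEq S] (M : TrackingModel S) {α : ℝ} (hα : 0 ≤ α)
    (hα' : α < 1) {b : S → ℝ} (hb : 0 ≤ b) :
    α * (b ⬝ᵥ fun x => M.discountedValue α (M.transMatrix x)) ≤ M.discountedValue α b := by
  have hone : ∀ x, 0 ≤ (1 : Matrix S S ℝ) x := fun x y => by
    rw [Matrix.one_apply]; split_ifs <;> simp
  have h : (b ⬝ᵥ fun x => M.discountedValue α ((1 : Matrix S S ℝ) x)) ≤ M.discountedValue α b := by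
    have hlim : Tendsto (fun n => b ⬝ᵥ fun x => M.valueIter α n ((1 : Matrix S S ℝ) x)) atTop
        (𝓝 (b ⬝ᵥ fun x => M.discountedValue α ((1 : Matrix S S ℝ) x))) :=
      tendsto_finsetSum _ fun x _ => (M.tendsto_valueIter hα hα' (hone x)).const_mul (b x)
    refine le_of_tendsto_of_tendsto' hlim (M.tendsto_valueIter hα hα' hb) fun n => ?_
    simpa using M.dotProduct_valueIter_le hα hb n 1
  refine le_trans ?_ h
  rw [← smul_eq_mul α, ← dotProduct_smul]
  refine dotProduct_le_dotProduct_of_nonneg_left (fun x => ?_) hb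
  have hx : (1 : Matrix S S ℝ) x ᵥ* M.transMatrix = M.transMatrix x := by
    rw [← Matrix.mul_apply_eq_vecMul, one_mul]
  rw [M.discountedValue_eq hα hα' (hone x)]
  refine le_min ?_ ?_
  · rw [hx]
    simpa using M.minLoss_nonneg (hone x)
  · simp [dotProduct, Matrix.one_apply, M.queryCost_nonneg]

end Discounted

end TrackingModel

/-! ### Vanishing discount and the average cost optimality equation. -/

namespace TrackingModel

open scoped Matrix

variable {S : Type*}

/-- A matrix has a bounded generalized inverse. -/
lemma exists_bounded_preimage [Fintype S] (A : Matrix S S ℝ) :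
    ∃ K : ℝ, 0 ≤ K ∧ ∀ v : S → ℝ, ∃ z : S → ℝ, A *ᵥ z = A *ᵥ v ∧ ‖z‖ ≤ K * ‖A *ᵥ v‖ := by
  -- A linear section of `A` over its range is continuous in finite dimension; its operator norm
  -- serves as `K`.
  obtain ⟨g, hg⟩ := A.mulVecLin.rangeRestrict.exists_rightInverse_of_surjective
    A.mulVecLin.range_rangeRestrict
  refine ⟨‖g.toContinuousLinearMap‖, g.toContinuousLinearMap.opNorm_nonneg, fun v => ?_⟩
  refine ⟨g (A.mulVecLin.rangeRestrict v), ?_, ?_⟩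
  · exact congrArg Subtype.val (LinearMap.congr_fun hg (A.mulVecLin.rangeRestrict v))
  · exact g.toContinuousLinearMap.le_opNorm (A.mulVecLin.rangeRestrict v)

lemma exists_tendsto_of_abs_le {β : Type*} (F : Ultrafilter β) {f : β → ℝ} {K : ℝ}
    (h : ∀ᶠ x in (F : Filter β), |f x| ≤ K) :
    ∃ l : ℝ, Tendsto f F (𝓝 l) ∧ |l| ≤ K := by
  obtain ⟨l, hl, hF⟩ := (isCompact_Icc (a := -K) (b := K)).ultrafilter_le_nhds (F.map f)
    (le_principal_iff.2 (h.mono fun x hx => abs_le.1 hx))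
  exact ⟨l, hF, abs_le.2 hl⟩

lemma abs_dotProduct_le [Fintype S] {b v : S → ℝ} (hb : b ∈ stdSimplex ℝ S) {K : ℝ}
    (hv : ∀ x, |v x| ≤ K) : |b ⬝ᵥ v| ≤ K := by
  calc |b ⬝ᵥ v| ≤ ∑ x, |b x * v x| := Finset.abs_sum_le_sum_abs _ _
    _ ≤ ∑ x, b x * K := by
      refine Finset.sum_le_sum fun x _ => ?_
      rw [abs_mul, abs_of_nonneg (hb.1 x)]
      exact mul_le_mul_of_nonneg_left (hv x) (hb.1 x)
    _ = K := by rw [← Finset.sum_mul, hb.2, one_mul]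

lemma transMatrix_mem_stdSimplex [Fintype S] (M : TrackingModel S) (x : S) :
    M.transMatrix x ∈ stdSimplex ℝ S :=
  ⟨M.transMatrix_nonneg x, M.sum_transMatrix x⟩

lemma vecMul_transMatrix_mem_stdSimplex [Fintype S] (M : TrackingModel S) {b : S → ℝ}
    (hb : b ∈ stdSimplex ℝ S) : b ᵥ* M.transMatrix ∈ stdSimplex ℝ S :=
  ⟨M.vecMul_transMatrix_nonneg hb.1, (M.sum_vecMul_transMatrix b).trans hb.2⟩

/-- The discounted value, up to a harmonic function of the state, is bounded uniformly in the
discount factor. -/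
lemma exists_harmonic_approximation [Fintype S] [DecidableEq S] [Nonempty S]
    (M : TrackingModel S) :
    ∃ (K : ℝ) (q : ℝ → S → ℝ), (∀ α, M.transMatrix *ᵥ q α = q α) ∧
      ∀ α, 0 ≤ α → α < 1 → (∀ x, |(1 - α) * q α x| ≤ K) ∧
        ∀ b ∈ stdSimplex ℝ S, |M.discountedValue α b - b ⬝ᵥ q α| ≤ K := by
  obtain ⟨K, hK, hinv⟩ := exists_bounded_preimage (1 - M.transMatrix)
  set v : ℝ → S → ℝ := fun α x => M.discountedValue α (M.transMatrix x) with hvdef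
  choose z hz hzK using fun α => hinv (v α)
  set c := M.queryCost
  have hc : 0 ≤ c := M.queryCost_nonneg
  have key : ∀ α, 0 ≤ α → α < 1 →
      (∀ x, 0 ≤ v α x) ∧ (∀ x, (1 - α) * v α x ≤ c) ∧ (∀ x, |z α x| ≤ K * c) := by
    intro α h0 h1
    have hpos : ∀ x, 0 ≤ v α x := fun x =>
      M.discountedValue_nonneg h0 h1 (M.transMatrix_nonneg x)
    have hle : ∀ x, (1 - α) * v α x ≤ c := fun x => by
      have h := M.discountedValue_le h0 h1 (M.transMatrix_nonneg x)
      rw [sum_transMatrix, mul_one, le_div_iff₀ (by linarith)] at h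
      linarith
    refine ⟨hpos, hle, fun x => ?_⟩
    -- From αPv ≤ v ≤ c + αPv and 0 ≤ (1 - α)Pv ≤ c it follows that v - Pv lies in [-c, c].
    have hd : ‖(1 - M.transMatrix) *ᵥ v α‖ ≤ c := by
      refine (pi_norm_le_iff_of_nonneg hc).2 fun x => ?_
      rw [Matrix.sub_mulVec, Matrix.one_mulVec, Pi.sub_apply, Real.norm_eq_abs, abs_le]
      have hl := M.dotProduct_discountedValue_le h0 h1 (M.transMatrix_nonneg x)
      have hu : v α x ≤ c + α * (M.transMatrix x ⬝ᵥ v α) := by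
        refine (M.discountedValue_eq h0 h1 (M.transMatrix_nonneg x)).le.trans
          ((min_le_right _ _).trans (le_of_eq ?_))
        simp only [dotProduct, mul_add, Finset.sum_add_distrib, ← Finset.sum_mul,
          sum_transMatrix, one_mul, Finset.mul_sum, c, hvdef]
        congr 1
        exact Finset.sum_congr rfl fun y _ => by ring
      have hP : (1 - α) * (M.transMatrix x ⬝ᵥ v α) ≤ c := by
        have h := abs_dotProduct_le (M.transMatrix_mem_stdSimplex x) (v := (1 - α) • v α) (K := c)
          fun y => by
            rw [Pi.smul_apply, smul_eq_mul, abs_of_nonneg]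
            · exact hle y
            · exact mul_nonneg (by linarith) (hpos y)
        rw [dotProduct_smul, smul_eq_mul] at h
        exact (abs_le.1 h).2
      have hP0 : 0 ≤ M.transMatrix x ⬝ᵥ v α :=
        Finset.sum_nonneg fun y _ => mul_nonneg (M.transMatrix_nonneg x y) (hpos y)
      change -c ≤ v α x - M.transMatrix x ⬝ᵥ v α ∧ v α x - M.transMatrix x ⬝ᵥ v α ≤ c
      change α * (M.transMatrix x ⬝ᵥ v α) ≤ v α x at hl
      constructor <;> nlinarith
    exact (norm_le_pi_norm (z α) x).trans ((hzK α).trans (mul_le_mul_of_nonneg_left hd hK))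
  -- Since `v` and `z` have the same image under 1 - P, their difference is harmonic. In the bound,
  -- `K * c` accounts for `z`, and `c` for (1 - α)v or for V(b) - b·v.
  refine ⟨K * c + c, fun α => v α - z α, fun α => ?_, fun α h0 h1 => ⟨fun x => ?_, fun b hb => ?_⟩⟩
  · have h := hz α
    rw [Matrix.sub_mulVec, Matrix.sub_mulVec, Matrix.one_mulVec, Matrix.one_mulVec] at h
    rw [Matrix.mulVec_sub]
    linear_combination h
  · obtain ⟨h2, h3, h4⟩ := key α h0 h1
    have := abs_le.1 (h4 x)
    have := h3 x
    have := mul_nonneg (sub_nonneg.2 h1.le) (h2 x)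
    have hKc : 0 ≤ K * c := mul_nonneg hK hc
    simp only [Pi.sub_apply, abs_le]
    constructor <;> nlinarith
  · obtain ⟨h2, h3, h4⟩ := key α h0 h1
    have hbz := abs_le.1 (abs_dotProduct_le hb h4)
    have hl := M.dotProduct_discountedValue_le h0 h1 hb.1
    change α * (b ⬝ᵥ v α) ≤ _ at hl
    have hu : M.discountedValue α b ≤ c + α * (b ⬝ᵥ v α) := by
      refine (M.discountedValue_eq h0 h1 hb.1).le.trans
        ((min_le_right _ _).trans (le_of_eq ?_))
      simp only [dotProduct, mul_add, Finset.sum_add_distrib, ← Finset.sum_mul,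
        hb.2, one_mul, Finset.mul_sum, c, hvdef]
      congr 1
      exact Finset.sum_congr rfl fun y _ => by ring
    have hbv0 : 0 ≤ b ⬝ᵥ v α := Finset.sum_nonneg fun y _ => mul_nonneg (hb.1 y) (h2 y)
    have hbv : (1 - α) * (b ⬝ᵥ v α) ≤ c := by
      have h := abs_dotProduct_le hb (v := (1 - α) • v α) (K := c) fun y => by
        rw [Pi.smul_apply, smul_eq_mul, abs_of_nonneg]
        · exact h3 y
        · exact mul_nonneg (by linarith) (h2 y)
      rw [dotProduct_smul, smul_eq_mul] at h
      exact (abs_le.1 h).2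
    rw [dotProduct_sub, abs_le]
    constructor <;> nlinarith

/-- The optimality equation of the average cost problem on beliefs has a bounded solution. -/
theorem exists_averageOptimalityEquation [Fintype S] [DecidableEq S] [Nonempty S]
    (M : TrackingModel S) :
    ∃ (U : (S → ℝ) → ℝ) (w : S → ℝ) (K : ℝ), M.transMatrix *ᵥ w = w ∧
      ∀ b ∈ stdSimplex ℝ S, |U b| ≤ K ∧
        U b = min (M.minLoss b - b ⬝ᵥ w + U (b ᵥ* M.transMatrix))
          (b ⬝ᵥ fun x => M.queryCost - w x + U (M.transMatrix x)) := by
  obtain ⟨K, q, hq, hK⟩ := M.exists_harmonic_approximation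
  -- An ultrafilter gives limits at all beliefs simultaneously, so neither a subsequence nor
  -- continuity in the belief is needed.
  let F : Ultrafilter ℝ := Ultrafilter.of (𝓝[<] (1 : ℝ))
  have hF : (F : Filter ℝ) ≤ 𝓝[<] (1 : ℝ) := Ultrafilter.of_le _
  have hmem : ∀ᶠ α : ℝ in F, 0 ≤ α ∧ α < 1 :=
    hF (Filter.mem_of_superset (Ioo_mem_nhdsLT (zero_lt_one' ℝ)) fun α hα => ⟨hα.1.le, hα.2⟩)
  have hα1 : Tendsto (fun α : ℝ => α) F (𝓝 1) := tendsto_id'.2 (hF.trans nhdsWithin_le_nhds)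
  have hw : ∀ x, ∃ l, Tendsto (fun α => (1 - α) * q α x) F (𝓝 l) ∧ |l| ≤ K := fun x =>
    exists_tendsto_of_abs_le F (hmem.mono fun α hα => (hK α hα.1 hα.2).1 x)
  choose w hw hwK using hw
  -- Off the simplex the value is irrelevant.
  have hU : ∀ b : S → ℝ, ∃ l, b ∈ stdSimplex ℝ S →
      Tendsto (fun α => M.discountedValue α b - b ⬝ᵥ q α) F (𝓝 l) ∧ |l| ≤ K := by
    intro b
    by_cases hb : b ∈ stdSimplex ℝ S
    · obtain ⟨l, hl⟩ := exists_tendsto_of_abs_le F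
        (hmem.mono fun α hα => (hK α hα.1 hα.2).2 b hb)
      exact ⟨l, fun _ => hl⟩
    · exact ⟨0, fun h => absurd h hb⟩
  choose U hU using hU
  refine ⟨U, w, K, ?_, fun b hb => ⟨(hU b hb).2, ?_⟩⟩
  · ext x
    refine tendsto_nhds_unique (f := fun α => (1 - α) * q α x) ?_ (hw x)
    have h : Tendsto (fun α => ∑ y, M.transMatrix x y * ((1 - α) * q α y)) F
        (𝓝 (∑ y, M.transMatrix x y * w y)) :=
      tendsto_finsetSum _ fun y _ => (hw y).const_mul _
    refine h.congr fun α => ?_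
    conv_rhs => rw [← hq α]
    simp only [Matrix.mulVec, dotProduct, Finset.mul_sum]
    exact Finset.sum_congr rfl fun y _ => by ring
  · refine tendsto_nhds_unique (hU b hb).1 ?_
    have hbw : Tendsto (fun α => b ⬝ᵥ ((1 - α) • q α)) F (𝓝 (b ⬝ᵥ w)) :=
      tendsto_finsetSum _ fun y _ => (hw y).const_mul _
    have hPred := (hbw.const_sub (M.minLoss b)).add
      (hα1.mul (hU _ (M.vecMul_transMatrix_mem_stdSimplex hb)).1)
    have hQuery : Tendsto (fun α => b ⬝ᵥ fun x => M.queryCost - (1 - α) * q α x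
        + α * (M.discountedValue α (M.transMatrix x) - M.transMatrix x ⬝ᵥ q α)) F
        (𝓝 (b ⬝ᵥ fun x => M.queryCost - w x + 1 * U (M.transMatrix x))) :=
      tendsto_finsetSum _ fun y _ => (((hw y).const_sub _).add
        (hα1.mul (hU _ (M.transMatrix_mem_stdSimplex y)).1)).const_mul _
    simp only [one_mul] at hPred hQuery
    refine (hPred.min hQuery).congr' (hmem.mono fun α hα => ?_)
    dsimp only
    -- Subtracting b·q from the Bellman equation leaves α b·q - b·q = -(1 - α) b·q in each branch,
    -- by harmonicity; this is the term that tends to -b·w.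
    rw [M.discountedValue_eq hα.1 hα.2 hb.1, bellman, ← min_sub_sub_right]
    congr 1
    · rw [← Matrix.dotProduct_mulVec, hq, dotProduct_smul, smul_eq_mul]
      ring
    · rw [← dotProduct_sub]
      congr 1
      ext x
      have : M.transMatrix x ⬝ᵥ q α = q α x := congrFun (hq α) x
      rw [this, Pi.sub_apply]
      ring

end TrackingModel

/-! ### Expected costs of a policy as costs to go. -/

section Expectation

open scoped ENNReal

lemma PMF.tsum_bind_mul {α β : Type*} (p : PMF α) (f : α → PMF β) (F : β → ℝ≥0∞) :
    ∑' b, p.bind f b * F b = ∑' a, p a * ∑' b, f a b * F b := by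
  simp_rw [PMF.bind_apply, ← ENNReal.tsum_mul_right, ← ENNReal.tsum_mul_left]
  rw [ENNReal.tsum_comm]
  simp_rw [mul_assoc]

lemma PMF.tsum_pure_mul {α : Type*} (a : α) (F : α → ℝ≥0∞) :
    ∑' b, PMF.pure a b * F b = F a := by
  rw [tsum_eq_single a fun b hb => by rw [PMF.pure_apply_of_ne _ _ hb, zero_mul],
    PMF.pure_apply_self, one_mul]

lemma PMF.tsum_map_mul {α β : Type*} (p : PMF α) (f : α → β) (F : β → ℝ≥0∞) :
    ∑' b, p.map f b * F b = ∑' a, p a * F (f a) := by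
  rw [PMF.map, PMF.tsum_bind_mul]
  simp_rw [Function.comp_apply, PMF.tsum_pure_mul]

lemma PMF.tsum_eq_ofReal {α : Type*} [Fintype α] (p : PMF α) {F : α → ℝ} (hF : ∀ a, 0 ≤ F a) :
    ∑' a, p a * ENNReal.ofReal (F a) = ENNReal.ofReal (∑ a, (p a).toReal * F a) := by
  rw [tsum_fintype, ENNReal.ofReal_sum_of_nonneg fun a _ =>
    mul_nonneg ENNReal.toReal_nonneg (hF a)]
  refine Finset.sum_congr rfl fun a _ => ?_
  rw [ENNReal.ofReal_mul ENNReal.toReal_nonneg, ENNReal.ofReal_toReal (p.apply_ne_top a)]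

end Expectation

/-- An action is either a query or a prediction. -/
def TrackingAction.equivOption (S : Type*) : Option S ≃ TrackingAction S where
  toFun
    | none => .query
    | some k => .predict k
  invFun
    | .query => none
    | .predict k => some k
  left_inv := by rintro (_ | _) <;> rfl
  right_inv := by rintro (_ | _) <;> rfl

instance {S : Type*} [Fintype S] : Fintype (TrackingAction S) :=
  Fintype.ofEquiv _ (TrackingAction.equivOption S)

lemma TrackingAction.sum_eq {S A : Type*} [Fintype S] [AddCommMonoid A]
    (F : TrackingAction S → A) : ∑ a, F a = F .query + ∑ k, F (.predict k) := by
  rw [← (TrackingAction.equivOption S).sum_comp, Fintype.sum_option]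
  rfl

namespace TrackingModel

open scoped Matrix

variable {S : Type*}

/-- The cost of a slot in which the state is `x`. -/
def slotCost (M : TrackingModel S) (x : S) : TrackingAction S → ℝ
  | .query => M.queryCost
  | .predict k => M.loss x k

lemma slotCost_nonneg (M : TrackingModel S) (x : S) (a : TrackingAction S) :
    0 ≤ M.slotCost x a := by
  cases a
  · exact M.queryCost_nonneg
  · exact M.loss_nonneg _ _

variable [Fintype S]

/-- The expected cost of the next `n` slots, given the present state and history. -/
noncomputable def costToGo (M : TrackingModel S) (π : OnlinePolicy S) :
    ℕ → S → TrackingHistory S → ℝ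
  | 0 => fun _ _ => 0
  | n + 1 => fun x h => ∑ a, (π h a).toReal *
      (M.slotCost x a + M.transMatrix x ⬝ᵥ fun y => costToGo M π n y (slotRecord x a :: h))

lemma costToGo_nonneg (M : TrackingModel S) (π : OnlinePolicy S) (n : ℕ) :
    ∀ x h, 0 ≤ M.costToGo π n x h := by
  induction n with
  | zero => exact fun _ _ => le_rfl
  | succ n ih =>
    exact fun x h => Finset.sum_nonneg fun a _ => mul_nonneg ENNReal.toReal_nonneg
      (add_nonneg (M.slotCost_nonneg x a)
        (Finset.sum_nonneg fun y _ => mul_nonneg (M.transMatrix_nonneg x y) (ih _ _)))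

lemma ofReal_costToGo_succ (M : TrackingModel S) (π : OnlinePolicy S) (n : ℕ) (x : S)
    (h : TrackingHistory S) :
    ENNReal.ofReal (M.costToGo π (n + 1) x h) = ∑' a, π h a * (ENNReal.ofReal (M.slotCost x a) +
      ∑' y, M.trans x y * ENNReal.ofReal (M.costToGo π n y (slotRecord x a :: h))) := by
  have hnn : ∀ a, 0 ≤ M.transMatrix x ⬝ᵥ fun y => M.costToGo π n y (slotRecord x a :: h) :=
    fun a => Finset.sum_nonneg fun y _ =>
      mul_nonneg (M.transMatrix_nonneg x y) (M.costToGo_nonneg π n _ _)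
  rw [costToGo, ← PMF.tsum_eq_ofReal _ fun a => add_nonneg (M.slotCost_nonneg x a) (hnn a)]
  refine tsum_congr fun a => ?_
  rw [ENNReal.ofReal_add (M.slotCost_nonneg x a) (hnn a),
    PMF.tsum_eq_ofReal _ fun y => M.costToGo_nonneg π n _ _]
  rfl

lemma expectedCost_nonneg (M : TrackingModel S) (ν : PMF S) (π : OnlinePolicy S) (t : ℕ) :
    0 ≤ M.expectedCost ν π t :=
  Finset.sum_nonneg fun x _ => add_nonneg (mul_nonneg ENNReal.toReal_nonneg M.queryCost_nonneg)
    (Finset.sum_nonneg fun k _ => mul_nonneg ENNReal.toReal_nonneg (M.loss_nonneg x k))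

lemma ofReal_expectedCost (M : TrackingModel S) (ν : PMF S) (π : OnlinePolicy S) (t : ℕ) :
    ENNReal.ofReal (M.expectedCost ν π t) =
      ∑' z, M.jointLaw ν π t z * ∑' a, π z.2 a * ENNReal.ofReal (M.slotCost z.1 a) := by
  have h : M.expectedCost ν π t =
      ∑ z : S × TrackingAction S, (M.slotLaw ν π t z).toReal * M.slotCost z.1 z.2 := by
    simp only [Fintype.sum_prod_type, TrackingAction.sum_eq, expectedCost, slotCost]
  rw [h, ← PMF.tsum_eq_ofReal (M.slotLaw ν π t) (F := fun z => M.slotCost z.1 z.2)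
    fun z => M.slotCost_nonneg z.1 z.2, slotLaw, PMF.tsum_bind_mul]
  simp_rw [PMF.tsum_map_mul]

/-- This links the forward recursion of `jointLaw` with the backward recursion of `costToGo`.
Working in the extended nonnegative reals avoids summability questions over the infinite set of
histories. -/
lemma tsum_jointLaw_costToGo (M : TrackingModel S) (ν : PMF S) (π : OnlinePolicy S) (n : ℕ) :
    ∀ t, ∑' z, M.jointLaw ν π t z * ENNReal.ofReal (M.costToGo π n z.1 z.2) =
      ENNReal.ofReal (∑ s ∈ Finset.range n, M.expectedCost ν π (t + s)) := by
  induction n with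
  | zero => simp [costToGo]
  | succ n ih =>
    intro t
    rw [Finset.sum_range_succ', add_comm (∑ s ∈ _, _), ENNReal.ofReal_add
      (M.expectedCost_nonneg ν π _) (Finset.sum_nonneg fun s _ => M.expectedCost_nonneg ν π _),
      add_zero, ofReal_expectedCost]
    have hshift : ∀ s, t + (s + 1) = t + 1 + s := fun s => by ring
    rw [Finset.sum_congr rfl fun s _ => by rw [hshift s]]
    rw [← ih (t + 1), jointLaw, PMF.tsum_bind_mul, ← ENNReal.tsum_add]
    refine tsum_congr fun z => ?_
    rw [ofReal_costToGo_succ, ← mul_add, PMF.tsum_bind_mul, ← ENNReal.tsum_add]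
    simp_rw [PMF.tsum_map_mul, mul_add]

lemma sum_expectedCost (M : TrackingModel S) (ν : PMF S) (π : OnlinePolicy S) (n : ℕ) :
    ∑ t ∈ Finset.range n, M.expectedCost ν π t =
      (fun x => (ν x).toReal) ⬝ᵥ fun x => M.costToGo π n x [] := by
  have h := M.tsum_jointLaw_costToGo ν π n 0
  rw [jointLaw, PMF.tsum_map_mul, PMF.tsum_eq_ofReal _ fun x => M.costToGo_nonneg π n x [],
    ENNReal.ofReal_eq_ofReal_iff] at h
  · simpa [dotProduct] using h.symm
  · exact Finset.sum_nonneg fun x _ =>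
      mul_nonneg ENNReal.toReal_nonneg (M.costToGo_nonneg π n x [])
  · exact Finset.sum_nonneg fun s _ => M.expectedCost_nonneg ν π _

lemma _root_.PMF.toReal_mem_stdSimplex {α : Type*} [Fintype α] (p : PMF α) :
    (fun a => (p a).toReal) ∈ stdSimplex ℝ α := by
  refine ⟨fun _ => ENNReal.toReal_nonneg, ?_⟩
  rw [← ENNReal.toReal_sum fun a _ => p.apply_ne_top a,
    ← tsum_fintype (L := .unconditional _), p.tsum_coe, ENNReal.toReal_one]

/-- The costs to go under a belief `b`, after a first action `a`. -/
lemma dotProduct_costToGo_succ (M : TrackingModel S) (π : OnlinePolicy S) (n : ℕ) (b : S → ℝ)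
    (h : TrackingHistory S) :
    (b ⬝ᵥ fun x => M.costToGo π (n + 1) x h) = ∑ a, (π h a).toReal * (b ⬝ᵥ fun x =>
      M.slotCost x a + M.transMatrix x ⬝ᵥ fun y => M.costToGo π n y (slotRecord x a :: h)) := by
  simp only [costToGo, dotProduct, Finset.mul_sum]
  rw [Finset.sum_comm]
  refine Finset.sum_congr rfl fun a _ => Finset.sum_congr rfl fun x _ => ?_
  ring

lemma dotProduct_predict (M : TrackingModel S) (π : OnlinePolicy S) (n : ℕ) (b : S → ℝ)
    (h : TrackingHistory S) (k : S) :
    (b ⬝ᵥ fun x => M.slotCost x (.predict k) + M.transMatrix x ⬝ᵥ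
        fun y => M.costToGo π n y (slotRecord x (.predict k) :: h)) =
      (b ⬝ᵥ fun x => M.loss x k) +
        (b ᵥ* M.transMatrix) ⬝ᵥ fun y => M.costToGo π n y (.predicted k :: h) := by
  rw [← Matrix.dotProduct_mulVec, ← dotProduct_add]
  rfl

end TrackingModel

/-! ### Threshold policies. -/

lemma one_le_of_latestQuery_eq_some {S : Type*} {h : TrackingHistory S} {i : S} {n : ℕ}
    (hq : latestQuery h = some (i, n)) : 1 ≤ n := by
  cases h with
  | nil => simp [latestQuery] at hq
  | cons r h =>
    cases r with
    | queried x =>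
      simp only [latestQuery, Option.some.injEq, Prod.mk.injEq] at hq
      exact hq.2.le
    | predicted k =>
      simp only [latestQuery, Option.map_eq_some_iff, Prod.mk.injEq] at hq
      obtain ⟨q, -, -, hq⟩ := hq
      omega

/-- The policy that predicts `k i n` as long as the time `n` since the latest query, which revealed
`i`, is less than `μ i`, and queries otherwise. -/
noncomputable def thresholdPolicy {S : Type*} (μ : S → ℕ∞) (k : S → ℕ → S) : OnlinePolicy S :=
  open Classical in fun h =>
    match latestQuery h with
    | none => PMF.pure .query
    | some (i, n) => if (n : ℕ∞) < μ i then PMF.pure (.predict (k i n)) else PMF.pure .query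

section ThresholdPolicy

variable {S : Type*} (μ : S → ℕ∞) (k : S → ℕ → S)

lemma thresholdPolicy_nil : thresholdPolicy μ k [] = PMF.pure .query := rfl

lemma thresholdPolicy_of_lt {h : TrackingHistory S} {i : S} {n : ℕ}
    (hq : latestQuery h = some (i, n)) (hn : (n : ℕ∞) < μ i) :
    thresholdPolicy μ k h = PMF.pure (.predict (k i n)) := by
  simp [thresholdPolicy, hq, hn]

lemma thresholdPolicy_of_eq {h : TrackingHistory S} {i : S} {n : ℕ}
    (hq : latestQuery h = some (i, n)) (hn : (n : ℕ∞) = μ i) :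
    thresholdPolicy μ k h = PMF.pure .query := by
  simp [thresholdPolicy, hq, hn]

lemma isStationaryPolicy_thresholdPolicy : IsStationaryPolicy (thresholdPolicy μ k) := by
  intro h h' i n hq hq'
  simp only [thresholdPolicy, hq, hq']

end ThresholdPolicy

lemma PMF.sum_pure_toReal_mul {α : Type*} [Fintype α] (a : α) (G : α → ℝ) :
    ∑ b, (PMF.pure a b).toReal * G b = G a := by
  classical
  simp [PMF.pure_apply, apply_ite ENNReal.toReal]

lemma tendsto_one_div_mul_add (g C : ℝ) :
    Tendsto (fun T : ℕ => (1 / (T : ℝ)) * (T * g + C)) atTop (𝓝 g) := by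
  have h : Tendsto (fun T : ℕ => g + C * (1 / (T : ℝ))) atTop (𝓝 (g + C * 0)) :=
    tendsto_const_nhds.add (tendsto_one_div_atTop_nhds_zero_nat.const_mul C)
  rw [mul_zero, add_zero] at h
  refine h.congr' ((eventually_ne_atTop 0).mono fun T hT => ?_)
  field_simp

/-! ### Verification: from the optimality equation to optimality. -/

namespace TrackingModel

open scoped Matrix

variable {S : Type*} [Fintype S]

lemma vecMul_dotProduct_eq {M : TrackingModel S} {w : S → ℝ} (hw : M.transMatrix *ᵥ w = w)
    (b : S → ℝ) : (b ᵥ* M.transMatrix) ⬝ᵥ w = b ⬝ᵥ w := by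
  rw [← Matrix.dotProduct_mulVec, hw]

/-- Bookkeeping for a query followed by `n` slots: as P_x·w = w x, the query slot itself can be
charged w x, which turns `n` into `n + 1`. -/
lemma dotProduct_query_add {M : TrackingModel S} {w : S → ℝ} (U : (S → ℝ) → ℝ)
    (hw : M.transMatrix *ᵥ w = w) {b : S → ℝ} (hb : b ∈ stdSimplex ℝ S) (n : ℕ) (K : ℝ) :
    (b ⬝ᵥ fun x => M.queryCost + (n * (M.transMatrix x ⬝ᵥ w) + U (M.transMatrix x) + K)) =
      ((n + 1 : ℕ) : ℝ) * (b ⬝ᵥ w) +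
        (b ⬝ᵥ fun x => M.queryCost - w x + U (M.transMatrix x)) + K := by
  have hK : K = b ⬝ᵥ fun _ => K := by simp [dotProduct, ← Finset.sum_mul, hb.2]
  conv_rhs => rw [hK]
  rw [← smul_eq_mul, ← dotProduct_smul, ← dotProduct_add, ← dotProduct_add]
  congr 1
  ext x
  have hx : M.transMatrix x ⬝ᵥ w = w x := congrFun hw x
  simp only [hx, Pi.add_apply, Pi.smul_apply, smul_eq_mul]
  push_cast
  ring

lemma pow_transMatrix_succ [DecidableEq S] (M : TrackingModel S) (n : ℕ) (i : S) :
    (M.transMatrix ^ (n + 1)) i = (M.transMatrix ^ n) i ᵥ* M.transMatrix := by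
  rw [pow_succ, Matrix.mul_apply_eq_vecMul]

lemma pow_transMatrix_mem_stdSimplex [DecidableEq S] (M : TrackingModel S) {n : ℕ} (hn : 1 ≤ n) (i : S) :
    (M.transMatrix ^ n) i ∈ stdSimplex ℝ S := by
  induction n, hn using Nat.le_induction with
  | base => rw [pow_one]; exact M.transMatrix_mem_stdSimplex i
  | succ n _ ih => rw [pow_transMatrix_succ]; exact M.vecMul_transMatrix_mem_stdSimplex ih

variable [Nonempty S]

/-- `U` and `w` solve the average cost optimality equation on beliefs, with `U` bounded by `K`. -/
def SolvesOptimalityEquation (M : TrackingModel S) (U : (S → ℝ) → ℝ) (w : S → ℝ) (K : ℝ) : Prop :=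
  M.transMatrix *ᵥ w = w ∧ ∀ b ∈ stdSimplex ℝ S, |U b| ≤ K ∧
    U b = min (M.minLoss b - b ⬝ᵥ w + U (b ᵥ* M.transMatrix))
      (b ⬝ᵥ fun x => M.queryCost - w x + U (M.transMatrix x))

/-- No policy beats the solution of the optimality equation by more than a constant. -/
lemma SolvesOptimalityEquation.le_costToGo {M : TrackingModel S} {U : (S → ℝ) → ℝ} {w : S → ℝ}
    {K : ℝ} (hU : M.SolvesOptimalityEquation U w K) (π : OnlinePolicy S) (n : ℕ) :
    ∀ b ∈ stdSimplex ℝ S, ∀ h, n * (b ⬝ᵥ w) + U b - K ≤ b ⬝ᵥ fun x => M.costToGo π n x h := by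
  -- The claim is for every pair of a belief and a history, related or not, so no posterior given
  -- the history has to be computed.
  induction n with
  | zero =>
    intro b hb h
    have := (abs_le.1 (hU.2 b hb).1).2
    simpa [costToGo, dotProduct] using this
  | succ n ih =>
    intro b hb h
    rw [dotProduct_costToGo_succ]
    have hsum := (π h).toReal_mem_stdSimplex
    -- Spreading the lower bound over the action probabilities reduces a randomized decision to
    -- single actions.
    rw [← one_mul (_ - K), ← hsum.2, Finset.sum_mul]
    refine Finset.sum_le_sum fun a _ => mul_le_mul_of_nonneg_left ?_ (hsum.1 a)
    cases a with
    | query =>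
      have h1 := (hU.2 b hb).2.trans_le (min_le_right _ _)
      have h2 := dotProduct_query_add U hU.1 hb n (-K)
      have h3 : (b ⬝ᵥ fun x => M.queryCost +
          (n * (M.transMatrix x ⬝ᵥ w) + U (M.transMatrix x) + -K)) ≤ b ⬝ᵥ fun x =>
          M.queryCost + M.transMatrix x ⬝ᵥ fun y => M.costToGo π n y (.queried x :: h) :=
        dotProduct_le_dotProduct_of_nonneg_left (fun x => add_le_add_right
          (ih _ (M.transMatrix_mem_stdSimplex x) (.queried x :: h)) _) hb.1
      simp only [slotCost, slotRecord]
      linarith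
    | predict k =>
      have h1 := (hU.2 b hb).2.trans_le (min_le_left _ _)
      have h2 := ih _ (M.vecMul_transMatrix_mem_stdSimplex hb) (.predicted k :: h)
      have h3 := M.minLoss_le b k
      rw [vecMul_dotProduct_eq hU.1] at h2
      rw [dotProduct_predict]
      push_cast
      linarith

variable [DecidableEq S]

/-- A policy that attains the minimum in the optimality equation costs at most a constant more
than the solution. -/
lemma SolvesOptimalityEquation.costToGo_le {M : TrackingModel S} {U : (S → ℝ) → ℝ} {w : S → ℝ}
    {K : ℝ} (hU : M.SolvesOptimalityEquation U w K) {μ : S → ℕ∞} {k : S → ℕ → S}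
    (hμ : ∀ i, 1 ≤ μ i)
    (hquery : ∀ i (n : ℕ), 1 ≤ n → (n : ℕ∞) = μ i → U ((M.transMatrix ^ n) i) =
      (M.transMatrix ^ n) i ⬝ᵥ fun x => M.queryCost - w x + U (M.transMatrix x))
    (hpredict : ∀ i (n : ℕ), 1 ≤ n → (n : ℕ∞) < μ i → U ((M.transMatrix ^ n) i) =
      M.predictionLoss i n (k i n) - (M.transMatrix ^ n) i ⬝ᵥ w + U ((M.transMatrix ^ (n + 1)) i))
    (N : ℕ) :
    ∀ (h : TrackingHistory S) (i : S) (n : ℕ), latestQuery h = some (i, n) → (n : ℕ∞) ≤ μ i →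
      ((M.transMatrix ^ n) i ⬝ᵥ fun x => M.costToGo (thresholdPolicy μ k) N x h) ≤
        N * ((M.transMatrix ^ n) i ⬝ᵥ w) + U ((M.transMatrix ^ n) i) + K := by
  induction N with
  | zero =>
    intro h i n hq _
    have := (abs_le.1 (hU.2 _
      (M.pow_transMatrix_mem_stdSimplex (one_le_of_latestQuery_eq_some hq) i)).1).1
    simp only [costToGo, dotProduct, mul_zero, Finset.sum_const_zero, Nat.cast_zero, zero_mul]
    linarith
  | succ N ih =>
    intro h i n hq hn
    have h1 := one_le_of_latestQuery_eq_some hq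
    have hb := M.pow_transMatrix_mem_stdSimplex h1 i
    rw [dotProduct_costToGo_succ]
    -- A prediction below the threshold keeps the elapsed time at most `μ i`; a query at the
    -- threshold restarts it at 1, where `hμ` applies.
    rcases hn.lt_or_eq with hn | hn
    · rw [thresholdPolicy_of_lt μ k hq hn, PMF.sum_pure_toReal_mul, dotProduct_predict,
        ← pow_transMatrix_succ]
      have h2 := ih (.predicted (k i n) :: h) i (n + 1) (by simp [latestQuery, hq])
        (by push_cast; exact Order.add_one_le_of_lt hn)
      have h3 := hpredict i n h1 hn
      rw [pow_transMatrix_succ M n i, vecMul_dotProduct_eq hU.1, ← pow_transMatrix_succ] at h2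
      change M.predictionLoss i n (k i n) + _ ≤ _
      push_cast
      linarith
    · rw [thresholdPolicy_of_eq μ k hq hn, PMF.sum_pure_toReal_mul]
      have h2 := hquery i n h1 hn
      rw [h2, ← dotProduct_query_add U hU.1 hb N K]
      refine dotProduct_le_dotProduct_of_nonneg_left (fun x => ?_) hb.1
      have h3 := ih (.queried x :: h) x 1 rfl (by exact_mod_cast hμ x)
      rw [pow_one] at h3
      exact add_le_add_right h3 _

/-- A threshold policy that attains the minimum in the optimality equation is optimal. -/
theorem SolvesOptimalityEquation.isOptimal {M : TrackingModel S} {U : (S → ℝ) → ℝ} {w : S → ℝ}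
    {K : ℝ} (hU : M.SolvesOptimalityEquation U w K) {μ : S → ℕ∞} {k : S → ℕ → S}
    (hμ : ∀ i, 1 ≤ μ i)
    (hquery : ∀ i (n : ℕ), 1 ≤ n → (n : ℕ∞) = μ i → U ((M.transMatrix ^ n) i) =
      (M.transMatrix ^ n) i ⬝ᵥ fun x => M.queryCost - w x + U (M.transMatrix x))
    (hpredict : ∀ i (n : ℕ), 1 ≤ n → (n : ℕ∞) < μ i → U ((M.transMatrix ^ n) i) =
      M.predictionLoss i n (k i n) - (M.transMatrix ^ n) i ⬝ᵥ w + U ((M.transMatrix ^ (n + 1)) i))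
    (ν : PMF S) : M.IsOptimal ν (thresholdPolicy μ k) := by
  set b : S → ℝ := fun x => (ν x).toReal with hbdef
  have hb : b ∈ stdSimplex ℝ S := ν.toReal_mem_stdSimplex
  -- The average runs over T + 1 slots, hence the extra b·w; one `K` comes from `le_costToGo`, the
  -- other from U b ≥ -K.
  have hlower : ∀ (π : OnlinePolicy S) (T : ℕ),
      (1 / (T : ℝ)) * (T * (b ⬝ᵥ w) + (b ⬝ᵥ w - 2 * K)) ≤ M.averageCost ν π T := by
    intro π T
    rw [averageCost, sum_expectedCost]
    refine mul_le_mul_of_nonneg_left ?_ (by positivity)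
    have h1 := hU.le_costToGo π (T + 1) b hb []
    have h2 := (abs_le.1 (hU.2 b hb).1).1
    push_cast at h1
    linarith
  refine ⟨b ⬝ᵥ w, ?_, fun π => ?_⟩
  · refine tendsto_of_tendsto_of_tendsto_of_le_of_le (tendsto_one_div_mul_add _ _)
      (tendsto_one_div_mul_add _ (b ⬝ᵥ w + (b ⬝ᵥ fun x => M.queryCost - w x +
        U (M.transMatrix x)) + K)) (hlower _) fun T => ?_
    dsimp only
    rw [averageCost, sum_expectedCost]
    refine mul_le_mul_of_nonneg_left ?_ (by positivity)
    -- The query in slot 0 brings the belief to a row of P, from which `costToGo_le` covers the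
    -- remaining `T` slots.
    rw [dotProduct_costToGo_succ, thresholdPolicy_nil, PMF.sum_pure_toReal_mul]
    have h1 := dotProduct_query_add U hU.1 hb T K
    have h2 : (b ⬝ᵥ fun x => M.queryCost + M.transMatrix x ⬝ᵥ fun y =>
        M.costToGo (thresholdPolicy μ k) T y [.queried x]) ≤ b ⬝ᵥ fun x => M.queryCost +
        (T * (M.transMatrix x ⬝ᵥ w) + U (M.transMatrix x) + K) := by
      refine dotProduct_le_dotProduct_of_nonneg_left (fun x => ?_) hb.1
      have h3 := hU.costToGo_le hμ hquery hpredict T [.queried x] x 1 rfl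
        (by exact_mod_cast hμ x)
      rw [pow_one] at h3
      exact add_le_add_right h3 _
    push_cast at h1
    simp only [slotCost, slotRecord]
    linarith
  · have hlim := (continuous_coe_real_ereal.tendsto _).comp
      (tendsto_one_div_mul_add (b ⬝ᵥ w) (b ⬝ᵥ w - 2 * K))
    rw [← hlim.liminf_eq]
    exact liminf_le_liminf (Eventually.of_forall fun T => EReal.coe_le_coe_iff.2 (hlower π T))

end TrackingModel

/-! ### The choice of the thresholds. -/

theorem lemma2 {S : Type*} [Fintype S] [DecidableEq S] [Nonempty S] (M : TrackingModel S) :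
    ∃ (π : OnlinePolicy S) (μ : S → ℕ∞),
      (∀ ν : PMF S, M.IsOptimal ν π) ∧
      IsStationaryPolicy π ∧
      π [] = PMF.pure .query ∧
      (∀ i, 1 ≤ μ i) ∧
      M.FollowsThresholds π μ := by
  obtain ⟨U, w, K, hU⟩ := M.exists_averageOptimalityEquation
  choose k hk using fun i n => Finite.exists_min (M.predictionLoss i n)
  -- The times at which querying attains the minimum. In `ℕ∞` the infimum of the empty set is `⊤`,
  -- which is the case of never querying again.
  let A : S → Set ℕ∞ := fun i => {m | ∃ n : ℕ, m = n ∧ 1 ≤ n ∧ U ((M.transMatrix ^ n) i) =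
    (M.transMatrix ^ n) i ⬝ᵥ fun x => M.queryCost - w x + U (M.transMatrix x)}
  have hμ : ∀ i, 1 ≤ sInf (A i) := fun i => le_sInf <| by
    rintro _ ⟨n, rfl, hn, -⟩
    exact_mod_cast hn
  refine ⟨thresholdPolicy (fun i => sInf (A i)) k, fun i => sInf (A i),
    TrackingModel.SolvesOptimalityEquation.isOptimal hU hμ ?_ ?_,
    isStationaryPolicy_thresholdPolicy _ _, thresholdPolicy_nil _ _, hμ, ?_⟩
  · intro i n _ hn
    have hne : (A i).Nonempty := by
      by_contra hA
      rw [Set.not_nonempty_iff_eq_empty.1 hA, sInf_empty] at hn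
      exact ENat.natCast_ne_top n hn
    obtain ⟨m, hm, -, hUm⟩ := csInf_mem hne
    rw [← hn] at hm
    rwa [Nat.cast_inj.1 hm]
  · intro i n h1 hn
    have hb := M.pow_transMatrix_mem_stdSimplex h1 i
    have hmin : M.minLoss ((M.transMatrix ^ n) i) = M.predictionLoss i n (k i n) :=
      le_antisymm (M.minLoss_le _ _) (Finset.le_inf' _ _ fun k' _ => hk i n k')
    -- Before the first such time querying is not a minimizer, so the minimum is attained by
    -- predicting.
    have hne : U ((M.transMatrix ^ n) i) ≠
        (M.transMatrix ^ n) i ⬝ᵥ fun x => M.queryCost - w x + U (M.transMatrix x) :=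
      fun h => (sInf_le (show (n : ℕ∞) ∈ A i from ⟨n, rfl, h1, h⟩)).not_gt hn
    rw [M.pow_transMatrix_succ, ← hmin]
    rcases min_choice (M.minLoss ((M.transMatrix ^ n) i) - (M.transMatrix ^ n) i ⬝ᵥ w +
      U (Matrix.vecMul ((M.transMatrix ^ n) i) M.transMatrix))
      ((M.transMatrix ^ n) i ⬝ᵥ fun x => M.queryCost - w x + U (M.transMatrix x)) with h | h
    · exact (hU.2 _ hb).2.trans h
    · exact absurd ((hU.2 _ hb).2.trans h) hne
  · exact fun h i n hq => ⟨fun hn => ⟨k i n, hk i n, thresholdPolicy_of_lt _ k hq hn⟩,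
      fun hn => thresholdPolicy_of_eq _ k hq hn⟩
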